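/- Let $d\ge 3$, let $\mathcal T$ be the $d$-regular tree and let $\iota$ be a legal coloring of $\mathcal T$, i.e. a map from the set of unoriented edges to $\{1,\dots,d\}$ whose restriction to the set $E(v)$ of edges containing $v$ is a bijection onto $\{1,\dots,d\}$ for every vertex $v$. Let $F\le \mathrm{Sym}\{1,\dots,d\}$ be a primitive permutation group, let $U(F)=\{g\in\mathrm{Aut}(\mathcal T) : \iota\circ g\circ(\iota|_{E(v)})^{-1}\in F \text{ for every vertex } v\}$, and let $\mathbb G=U(F)^+$ be the subgroup of $U(F)$ generated by the elements of $U(F)$ that fix both endpoints of some edge. Fix a vertex $x$ and an edge $e$ containing $x$. Let $K=\mathbb G_x$ be the stabilizer of $x$ in $\mathbb G$, and let $\mathcal T_{x,e}$ be the half-tree emanating from $x$ and containing $e$, i.e. the subtree spanned by $x$ and all vertices $z$ such that the geodesic $[x,z]$ contains $e$. For $\gamma\in\mathrm{Aut}(\mathcal T)$ put $|\gamma|=\min_{v}\operatorname{dist}(v,\gamma(v))$ (minimum over the vertices $v$) and $\mathrm{Min}(\gamma)=\{v:\operatorname{dist}(v,\gamma(v))=|\gamma|\}$; $\gamma$ is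 hyperbolic if it fixes no vertex and leaves no edge invariant. Let $$A^+=\{\gamma\in\mathbb G : \gamma \text{ is hyperbolic},\ e\subset\mathrm{Min}(\gamma),\ \gamma(e)\subset\mathcal T_{x,e}\}\cup\{\mathrm{id}\}.$$ For $\gamma_1,\gamma_2\in A^+$ with $|\gamma_1|=|\gamma_2|=2$, the pair $(\gamma_1,\gamma_2)$ is called $K$-primitive if there is $k\in K$ with $k\gamma_1(e)=\gamma_2(e)$. (1) Every $\gamma\in A^+$ can be written as $\gamma=\gamma_1\gamma_2\cdots\gamma_t$ with $t\ge 0$, $\gamma_i\in A^+$ and $|\gamma_i|=2$ for all $i\in\{1,\dots,t\}$ (the empty product, $t=0$, being the identity). (2) Let $t\ge 1$ and let $\gamma_1,\dots,\gamma_t,\gamma_1',\dots,\gamma_t'\in A^+$ with $|\gamma_i|=|\gamma_i'|=2$ for all $i\in\{1,\dots,t\}$. Then $K\gamma_1\gamma_2\cdots\gamma_tK=K\gamma_1'\gamma_2'\cdots\gamma_t'K$ if and only if $(\gamma_i,\gamma_i')$ is a $K$-primitive pair for every $i\in\{1,\dots,t-1\}$ and $K\gamma_tK=K\gamma_t'K$.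 -/

import Mathlib

namespace BurgerMozes

variable {V : Type*} {T : SimpleGraph V}

/-- A legal coloring of `T`: a coloring of the unoriented edges by `d` colors whose restriction to
the star `E(v)` (the set of edges containing `v`) is a bijection onto the set of colors, for every
vertex `v`. -/
def IsLegalColoring {d : ℕ} (ι : T.edgeSet → Fin d) : Prop :=
  ∀ v : V, Set.BijOn ι {ε | v ∈ (ε : Sym2 V)} Set.univ

/-- The automorphism `g` acts at the vertex `v` by the color permutation `σ`, that is
`ι ∘ g = σ ∘ ι` on the star `E(v)`. For a legal coloring this says exactly that
`σ = ι ∘ g ∘ (ι|E(v))⁻¹`. -/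
def ActsLocallyBy {d : ℕ} (ι : T.edgeSet → Fin d) (g : T ≃g T) (v : V)
    (σ : Equiv.Perm (Fin d)) : Prop :=
  ∀ ε : T.edgeSet, v ∈ (ε : Sym2 V) → ι (g.mapEdgeSet ε) = σ (ι ε)

/-- The universal group `U(F)`: all automorphisms of `T` whose local action at every vertex
belongs to `F`. -/
def universalGroup {d : ℕ} (ι : T.edgeSet → Fin d) (F : Subgroup (Equiv.Perm (Fin d))) :
    Subgroup (T ≃g T) where
  carrier := {g | ∀ v : V, ∃ σ ∈ F, ActsLocallyBy ι g v σ}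
  one_mem' := by
    intro v
    refine ⟨1, F.one_mem, fun ε _ => ?_⟩
    have h : (1 : T ≃g T).mapEdgeSet ε = ε := by
      apply Subtype.ext
      change Sym2.map (fun z : V => z) (ε : Sym2 V) = ε
      exact congrFun Sym2.map_id _
    rw [h]
    rfl
  mul_mem' := by
    intro a b ha hb v
    obtain ⟨σ, hσ, h1⟩ := hb v
    obtain ⟨τ, hτ, h2⟩ := ha (b v)
    refine ⟨τ * σ, F.mul_mem hτ hσ, fun ε hε => ?_⟩
    have h : (a * b).mapEdgeSet ε = a.mapEdgeSet (b.mapEdgeSet ε) := by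
      apply Subtype.ext
      change Sym2.map (fun z : V => a (b z)) (ε : Sym2 V) = Sym2.map a (Sym2.map b (ε : Sym2 V))
      rw [Sym2.map_map]
      rfl
    have hb' : b v ∈ ((b.mapEdgeSet ε : T.edgeSet) : Sym2 V) := Sym2.mem_map.2 ⟨v, hε, rfl⟩
    rw [h, h2 _ hb', h1 _ hε]
    rfl
  inv_mem' := by
    intro a ha v
    obtain ⟨σ, hσ, h1⟩ := ha (a⁻¹ v)
    refine ⟨σ⁻¹, F.inv_mem hσ, fun ε hε => ?_⟩
    have h : a.mapEdgeSet ((a⁻¹).mapEdgeSet ε) = ε := a.mapEdgeSet.apply_symm_apply ε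
    have hv : a⁻¹ v ∈ (((a⁻¹).mapEdgeSet ε : T.edgeSet) : Sym2 V) := Sym2.mem_map.2 ⟨v, hε, rfl⟩
    have h3 := h1 _ hv
    rw [h] at h3
    rw [h3]
    exact (σ.symm_apply_apply _).symm

/-- The group `U(F)⁺`: the subgroup of `U(F)` generated by the stabilizers of edges, i.e. by the
elements of `U(F)` that fix (both endpoints of) some edge of `T`. -/
def universalGroupPlus {d : ℕ} (ι : T.edgeSet → Fin d) (F : Subgroup (Equiv.Perm (Fin d))) :
    Subgroup (T ≃g T) :=
  Subgroup.closure {g | g ∈ universalGroup ι F ∧ ∃ u v : V, T.Adj u v ∧ g u = u ∧ g v = v}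

/-- The stabilizer in a group `G` of automorphisms of the vertex `x`. -/
def vertexStabilizer (G : Subgroup (T ≃g T)) (x : V) : Subgroup (T ≃g T) where
  carrier := {g | g ∈ G ∧ g x = x}
  one_mem' := ⟨G.one_mem, rfl⟩
  mul_mem' := by
    rintro a b ⟨ha, hax⟩ ⟨hb, hbx⟩
    refine ⟨G.mul_mem ha hb, ?_⟩
    change a (b x) = x
    rw [hbx, hax]
  inv_mem' := by
    rintro a ⟨ha, hax⟩
    refine ⟨G.inv_mem ha, ?_⟩
    exact a.toEquiv.symm_apply_eq.2 hax.symm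

/-- An automorphism of a tree is hyperbolic if it fixes no vertex and inverts (or fixes) no edge,
equivalently if it has no fixed point in the geometric realization of the tree. -/
def IsHyperbolic (γ : T ≃g T) : Prop :=
  (∀ v : V, γ v ≠ v) ∧ ∀ ε ∈ T.edgeSet, Sym2.map γ ε ≠ ε

/-- The translation length `|γ|`, the minimum of `dist(v, γ v)` over all vertices `v`. -/
noncomputable def translationLength (γ : T ≃g T) : ℕ :=
  sInf (Set.range fun v : V => T.dist v (γ v))

/-- The set `Min(γ)` of the vertices that are displaced by exactly `|γ|`. -/
def minSet (γ : T ≃g T) : Set V :=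
  {v | T.dist v (γ v) = translationLength γ}

/-- The (vertices of the) half-tree of the tree `T` that emanates from `x` and contains the edge
`e` of the star of `x`: the vertex `x`, and all `z` for which the geodesic from `x` to `z` passes
through `e`. -/
def halfTree (T : SimpleGraph V) (x : V) (e : Sym2 V) : Set V :=
  {z | z = x ∨ ∃ p : T.Walk x z, p.IsPath ∧ e ∈ p.edges}

/-- The set `A⁺` attached to a group `G` of automorphisms, a vertex `x` and an edge `e` of its star:
the identity, and all hyperbolic `γ ∈ G` such that `e ⊆ Min(γ)` and `γ(e)` lies in the half-tree
emanating from `x` and containing `e`. -/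
def APlus (G : Subgroup (T ≃g T)) (x : V) (e : Sym2 V) : Set (T ≃g T) :=
  {γ | γ ∈ G ∧ IsHyperbolic γ ∧ (∀ z ∈ e, z ∈ minSet γ) ∧
    ∀ z ∈ Sym2.map γ e, z ∈ halfTree T x e} ∪ {1}

/-- `K`-primitive pairs, where `K` is the stabilizer of `x` in `G`: pairs of elements of `A⁺` of
translation length `2` such that `k γ₁(e) = γ₂(e)` for some `k ∈ K`. -/
def IsPrimitivePair (G : Subgroup (T ≃g T)) (x : V) (e : Sym2 V) (γ₁ γ₂ : T ≃g T) : Prop :=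
  γ₁ ∈ APlus G x e ∧ γ₂ ∈ APlus G x e ∧ translationLength γ₁ = 2 ∧ translationLength γ₂ = 2 ∧
    ∃ k ∈ vertexStabilizer G x, Sym2.map k (Sym2.map γ₁ e) = Sym2.map γ₂ e

/-- The double coset `K γ K`, where `K` is the stabilizer of `x` in `G`. -/
def doubleCosetK (G : Subgroup (T ≃g T)) (x : V) (γ : T ≃g T) : Set (T ≃g T) :=
  DoubleCoset.doubleCoset γ (vertexStabilizer G x : Set (T ≃g T)) (vertexStabilizer G x)

end BurgerMozes

namespace BurgerMozes

variable {V : Type*} {T : SimpleGraph V}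

/-! ### Distances in trees -/

/-! Write e = xy. Apart from the identity, A⁺ consists of the elements of the group that push the
oriented edge (x, y) forward along a geodesic (`Pushes`). Pushing lengths add under products, so
translation lengths do too.

Decomposition: elements of U(F)⁺ move every vertex an even distance. If U(F)⁺ is nontrivial,
primitivity of F makes vertex stabilizers in U(F)⁺ transitive on neighbors
(`exists_mem_universalGroupPlus_map_adj`). So some a in U(F)⁺ carries e two steps towards γx; split
it off and induct (`exists_list_of_pushes`).

Double cosets: KaK is the K-orbit of ax. The core is `exists_stabilizer_mul_iff`. An element of K
taking abx to a'b'x carries one geodesic from x to the other, hence a(e) to a'(e). Conversely,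
elements of K matching a(e) with a'(e) and bx with b'x are glued across a(e) by Tits' independence
property (`exists_mem_universalGroup_half`). -/

lemma exists_adj_dist_lt (hT : T.Connected) {a b : V} (hab : a ≠ b) :
    ∃ c, T.Adj a c ∧ T.dist c b + 1 = T.dist a b := by
  obtain ⟨p, hp⟩ := hT.exists_walk_length_eq_dist a b
  cases p with
  | nil => exact absurd rfl hab
  | @cons _ c _ h q =>
    refine ⟨c, h, ?_⟩
    have h1 := T.dist_le q
    have h2 := hT.dist_triangle (u := a) (v := c) (w := b)
    have h3 := SimpleGraph.dist_eq_one_iff_adj.2 h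
    simp only [SimpleGraph.Walk.length_cons] at hp
    omega

lemma adj_unique_of_dist_lt (hT : T.IsTree) {a b c z : V} (hb : T.Adj a b) (hc : T.Adj a c)
    (hbz : T.dist b z + 1 = T.dist a z) (hcz : T.dist c z + 1 = T.dist a z) : b = c := by
  obtain ⟨p, hp⟩ := hT.connected.exists_walk_length_eq_dist b z
  obtain ⟨q, hq⟩ := hT.connected.exists_walk_length_eq_dist c z
  have hp' : (SimpleGraph.Walk.cons hb p).IsPath :=
    SimpleGraph.Walk.isPath_of_length_eq_dist _ (by simp [hp, hbz])
  have hq' : (SimpleGraph.Walk.cons hc q).IsPath :=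
    SimpleGraph.Walk.isPath_of_length_eq_dist _ (by simp [hq, hcz])
  have h := congrArg (fun w : T.Path a z => (w : T.Walk a z).snd)
    ((hT.isAcyclic.subsingleton_path a z).elim ⟨_, hp'⟩ ⟨_, hq'⟩)
  simpa using h

/-- If the edge `yz` points away from `x` and towards `w`, it lies on the geodesic from `x`
to `w`. -/
lemma dist_eq_of_edge_between (hT : T.IsTree) {x y z w : V} (hyz : T.Adj y z)
    (hx : T.dist x z = T.dist x y + 1) (hw : T.dist y w = T.dist z w + 1) :
    T.dist x w = T.dist x y + 1 + T.dist z w := by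
  suffices H : ∀ n x, T.dist x y = n → T.dist x z = n + 1 →
      T.dist x w = n + 1 + T.dist z w from H _ _ rfl hx
  intro n
  induction n with
  | zero =>
    intro x h0 _
    have : x = y := hT.connected.dist_eq_zero_iff.1 h0
    subst this
    omega
  | succ n ih =>
    intro x h1 h2
    have hxy : x ≠ y := by rintro rfl; simp at h1
    obtain ⟨c, hc, hcy⟩ := exists_adj_dist_lt hT.connected hxy
    have hcz : T.dist c z = n + 2 - 1 := by
      have := hT.connected.dist_triangle (u := c) (v := y) (w := z)
      have := hT.connected.dist_triangle (u := x) (v := c) (w := z)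
      rw [SimpleGraph.dist_eq_one_iff_adj.2 hyz] at *
      rw [SimpleGraph.dist_eq_one_iff_adj.2 hc] at *
      omega
    have hcw := ih c (by omega) (by omega)
    rcases hT.dist_eq_dist_add_one_of_adj w hc with h | h
    · rw [T.dist_comm (u := w) (v := x), T.dist_comm (u := w) (v := c)] at h
      omega
    -- Here `x` is the neighbor of `c` towards `w`. But the next vertex from `c` on the way to `y`
    -- (or `z`, if `c = y`) is also nearer to `w`, so it would be `x`, which is farther from `y`.
    · exfalso
      rw [T.dist_comm (u := w) (v := x), T.dist_comm (u := w) (v := c)] at h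
      by_cases hcy' : c = y
      · subst hcy'
        have : x = z := adj_unique_of_dist_lt hT hc.symm hyz h.symm hw.symm
        subst this
        simp at h2
      · obtain ⟨b, hb, hby⟩ := exists_adj_dist_lt hT.connected hcy'
        have hbz : T.dist b z = T.dist b y + 1 := by
          have := hT.connected.dist_triangle (u := b) (v := y) (w := z)
          have := hT.connected.dist_triangle (u := c) (v := b) (w := z)
          rw [SimpleGraph.dist_eq_one_iff_adj.2 hyz] at *
          rw [SimpleGraph.dist_eq_one_iff_adj.2 hb] at *
          omega
        have hbw : T.dist b w + 1 = T.dist c w := by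
          rcases hT.dist_eq_dist_add_one_of_adj w hb with h' | h'
          · rw [T.dist_comm (u := w) (v := b), T.dist_comm (u := w) (v := c)] at h'
            exact h'.symm
          · exfalso
            have := hT.connected.dist_triangle (u := b) (v := z) (w := w)
            rw [T.dist_comm (u := w) (v := b), T.dist_comm (u := w) (v := c)] at h'
            omega
        have : x = b := adj_unique_of_dist_lt hT hc.symm hb h.symm hbw
        subst this
        omega

/-- A first step from `x` towards `p` or `q` is a step towards `z`, hence the same step; induct on
the distance. -/
lemma eq_of_dist_eq_on_geodesic (hT : T.IsTree) {x z : V} : ∀ {p q : V},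
    T.dist x p = T.dist x q → T.dist x p + T.dist p z = T.dist x z →
    T.dist x q + T.dist q z = T.dist x z → p = q := by
  suffices H : ∀ n (p q : V), T.dist x p = n → T.dist x q = n → n + T.dist p z = T.dist x z →
      n + T.dist q z = T.dist x z → p = q by
    intro p q h h1 h2
    exact H _ p q rfl h.symm h1 (by omega)
  suffices H : ∀ n x, ∀ (p q : V), T.dist x p = n → T.dist x q = n →
      n + T.dist p z = T.dist x z → n + T.dist q z = T.dist x z → p = q from fun n => H n x
  intro n
  induction n with
  | zero =>
    intro x p q hp hq _ _
    rw [hT.connected.dist_eq_zero_iff] at hp hq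
    exact hp.symm.trans hq
  | succ n ih =>
    intro x p q hp hq hpz hqz
    have key : ∀ r, T.dist x r = n + 1 → n + 1 + T.dist r z = T.dist x z →
        ∃ c, T.Adj x c ∧ T.dist c r = n ∧ n + T.dist r z = T.dist c z ∧
          T.dist c z + 1 = T.dist x z := by
      intro r hr hrz
      obtain ⟨c, hc, hcr⟩ := exists_adj_dist_lt hT.connected (a := x) (b := r)
        (by rintro rfl; simp at hr)
      have h1 := hT.connected.dist_triangle (u := c) (v := r) (w := z)
      have h2 := hT.connected.dist_triangle (u := x) (v := c) (w := z)
      rw [SimpleGraph.dist_eq_one_iff_adj.2 hc] at h2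
      exact ⟨c, hc, by omega, by omega, by omega⟩
    obtain ⟨c, hc, hcp, hpz', hcz⟩ := key p hp hpz
    obtain ⟨c', hc', hcq, hqz', hcz'⟩ := key q hq hqz
    obtain rfl := adj_unique_of_dist_lt hT hc hc' hcz hcz'
    exact ih c p q hcp hcq hpz' hqz'

/-- Trees are bipartite: moving `b` across one edge changes two of the three distances by one each.
-/
lemma even_dist_triangle (hT : T.IsTree) (a b c : V) :
    Even (T.dist a b + T.dist b c + T.dist a c) := by
  obtain ⟨p⟩ := hT.connected b c
  induction p with
  | nil => exact by simp
  | @cons u v w h p ih =>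
    have h1 := hT.dist_eq_dist_add_one_of_adj a h
    have h2 := hT.dist_eq_dist_add_one_of_adj w h
    rw [T.dist_comm (u := w) (v := u), T.dist_comm (u := w) (v := v)] at h2
    rw [Nat.even_iff] at *
    omega

/-! ### Automorphisms -/

lemma one_apply (v : V) : (1 : T ≃g T) v = v := rfl

lemma mul_apply (g h : T ≃g T) (v : V) : (g * h) v = g (h v) := rfl

lemma inv_apply_self (g : T ≃g T) (v : V) : g⁻¹ (g v) = v := g.toEquiv.symm_apply_apply v

lemma apply_inv_self (g : T ≃g T) (v : V) : g (g⁻¹ v) = v := g.toEquiv.apply_symm_apply v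

lemma dist_le_dist_map (hT : T.Connected) (g : T ≃g T) (u v : V) :
    T.dist (g u) (g v) ≤ T.dist u v := by
  obtain ⟨p, hp⟩ := hT.exists_walk_length_eq_dist u v
  rw [← hp, ← SimpleGraph.Walk.length_map g.toHom p]
  exact T.dist_le _

lemma dist_map (hT : T.Connected) (g : T ≃g T) (u v : V) :
    T.dist (g u) (g v) = T.dist u v := by
  refine le_antisymm (dist_le_dist_map hT g u v) ?_
  have := dist_le_dist_map hT g⁻¹ (g u) (g v)
  rwa [inv_apply_self, inv_apply_self] at this

lemma dist_inv_map (hT : T.Connected) (g : T ≃g T) (u v : V) :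
    T.dist u (g⁻¹ v) = T.dist (g u) v := by
  rw [← dist_map hT g, apply_inv_self]

/-- `g` moves the oriented edge `(x, y)` forward by `n` steps along a geodesic. -/
structure Pushes (x y : V) (n : ℕ) (g : T ≃g T) : Prop where
  left : T.dist x (g x) = n
  inner : T.dist y (g x) + 1 = n
  outer : T.dist x (g y) = n + 1

namespace Pushes

variable {x y : V} {n m : ℕ} {g h : T ≃g T}

lemma right (hT : T.IsTree) (hxy : T.Adj x y) (hg : Pushes x y n g) : T.dist y (g y) = n := by
  have h1 := hT.connected.dist_triangle (u := x) (v := y) (w := g y)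
  have h2 := hT.connected.dist_triangle (u := y) (v := g x) (w := g y)
  have := hg.inner
  have := hg.outer
  rw [dist_map hT.connected, SimpleGraph.dist_eq_one_iff_adj.2 hxy] at h2
  rw [SimpleGraph.dist_eq_one_iff_adj.2 hxy] at h1
  omega

/-- Extension of a geodesic beyond the image of the edge. -/
lemma dist_apply (hT : T.IsTree) (hxy : T.Adj x y) (hg : Pushes x y n g) {w : V}
    (hw : T.dist x w = T.dist y w + 1) :
    T.dist x (g w) = n + T.dist x w ∧ T.dist y (g w) + 1 = n + T.dist x w := by
  have hadj : T.Adj (g x) (g y) := g.map_adj_iff.2 hxy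
  have hw' : T.dist (g x) (g w) = T.dist (g y) (g w) + 1 := by
    rwa [dist_map hT.connected, dist_map hT.connected]
  have h1 := dist_eq_of_edge_between hT (x := x) hadj (by rw [hg.left, hg.outer]) hw'
  have h2 := dist_eq_of_edge_between hT (x := y) hadj
    (by rw [hg.right hT hxy, hg.inner]) hw'
  rw [dist_map hT.connected] at h1 h2
  have := hg.left
  have := hg.inner
  omega

lemma mul (hT : T.IsTree) (hxy : T.Adj x y) (hg : Pushes x y n g) (hh : Pushes x y m h) :
    Pushes x y (n + m) (g * h) := by
  have h1 := hh.left
  have h2 := hh.inner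
  have h3 := hh.outer
  have h4 := hh.right hT hxy
  have h5 := hg.dist_apply hT hxy (w := h x) (by omega)
  have h6 := hg.dist_apply hT hxy (w := h y) (by omega)
  constructor <;> simp only [mul_apply] <;> omega

lemma pow (hT : T.IsTree) (hxy : T.Adj x y) (hg : Pushes x y n g) (k : ℕ) :
    Pushes x y ((k + 1) * n) (g ^ (k + 1)) := by
  induction k with
  | zero => simpa using hg
  | succ k ih =>
    rw [pow_succ, Nat.succ_mul]
    exact ih.mul hT hxy hg

lemma le_dist (hT : T.IsTree) (hxy : T.Adj x y) (hg : Pushes x y n g) (v : V) :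
    n ≤ T.dist v (g v) := by
  have key : ∀ k : ℕ, T.dist v ((g ^ k) v) ≤ k * T.dist v (g v) := by
    intro k
    induction k with
    | zero => simp
    | succ k ih =>
      have := hT.connected.dist_triangle (u := v) (v := (g ^ k) v) (w := (g ^ (k + 1)) v)
      rw [pow_succ, mul_apply, dist_map hT.connected] at this
      rw [pow_succ, mul_apply]
      linarith [Nat.succ_mul k (T.dist v (g v))]
  by_contra! hlt
  -- If `v` moved less than `n`, the orbits of `x` and `v` would separate by at least one per
  -- iterate, yet their displacements differ by at most `2 * T.dist x v`; the power `k + 1` exceeds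
  -- this bound.
  set k := 2 * T.dist x v
  have h1 := (hg.pow hT hxy k).left
  have h2 := key (k + 1)
  have h3 := hT.connected.dist_triangle (u := x) (v := v) (w := (g ^ (k + 1)) x)
  have h4 := hT.connected.dist_triangle (u := v) (v := (g ^ (k + 1)) v) (w := (g ^ (k + 1)) x)
  rw [dist_map hT.connected, T.dist_comm (u := v) (v := x)] at h4
  have h5 : (k + 1) * (T.dist v (g v) + 1) ≤ (k + 1) * n := Nat.mul_le_mul_left _ hlt
  rw [mul_add] at h5
  omega

lemma translationLength_eq (hT : T.IsTree) (hxy : T.Adj x y) (hg : Pushes x y n g) :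
    translationLength g = n := by
  have hne : (Set.range fun v : V => T.dist v (g v)).Nonempty := ⟨_, x, rfl⟩
  refine le_antisymm (Nat.sInf_le ⟨x, hg.left⟩) ?_
  obtain ⟨v, hv⟩ := Nat.sInf_mem hne
  rw [translationLength, ← hv]
  exact hg.le_dist hT hxy v

lemma isHyperbolic (hT : T.IsTree) (hxy : T.Adj x y) (hg : Pushes x y n g) :
    IsHyperbolic g := by
  have hn := hg.inner
  -- The field `inner` makes `n` a successor. An inverted edge is excluded by applying this to `g *
  -- g`, which would fix its ends.
  have hfix : ∀ {k} {g : T ≃g T}, Pushes x y (k + 1) g → ∀ v, g v ≠ v := by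
    intro k g hg v hv
    have := hg.le_dist hT hxy v
    rw [hv] at this
    simp at this
  subst hn
  refine ⟨hfix hg, fun ε => ?_⟩
  induction ε using Sym2.ind with
  | _ a b =>
    intro _ h
    rw [Sym2.map_mk, Sym2.eq_iff] at h
    rcases h with ⟨h, -⟩ | ⟨h, h'⟩
    · exact hfix hg a h
    · have h2 := hg.mul hT hxy hg
      rw [← add_assoc] at h2
      exact hfix h2 a (by rw [mul_apply, h, h'])

end Pushes

lemma mem_halfTree_iff (hT : T.IsTree) {x y z : V} (hxy : T.Adj x y) :
    z ∈ halfTree T x s(x, y) ↔ z = x ∨ T.dist x z = T.dist y z + 1 := by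
  classical
  refine or_congr_right ⟨?_, fun h => ?_⟩
  · rintro ⟨p, hp, he⟩
    obtain ⟨q, hq, hq'⟩ := hT.connected.exists_path_of_dist x z
    have hpq : p = q := congrArg Subtype.val ((hT.isAcyclic.subsingleton_path x z).elim ⟨p, hp⟩ ⟨q, hq⟩)
    have hy : y ∈ p.support := p.snd_mem_support_of_mem_edges he
    have h1 := congrArg SimpleGraph.Walk.length (p.take_spec hy)
    have h0 := congrArg SimpleGraph.Walk.length hpq
    rw [SimpleGraph.Walk.length_append] at h1
    have h2 := T.dist_le (p.takeUntil y hy)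
    have h3 := T.dist_le (p.dropUntil y hy)
    have h4 := hT.connected.dist_triangle (u := x) (v := y) (w := z)
    rw [SimpleGraph.dist_eq_one_iff_adj.2 hxy] at h2 h4
    omega
  · obtain ⟨q, hq⟩ := hT.connected.exists_walk_length_eq_dist y z
    exact ⟨.cons hxy q, SimpleGraph.Walk.isPath_of_length_eq_dist _ (by simp [hq, h]), by simp⟩

lemma Pushes.mem_APlus {G : Subgroup (T ≃g T)} {x y : V} {n : ℕ} {g : T ≃g T} (hT : T.IsTree)
    (hxy : T.Adj x y) (hg : Pushes x y n g) (hG : g ∈ G) : g ∈ APlus G x s(x, y) := by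
  refine Or.inl ⟨hG, hg.isHyperbolic hT hxy, ?_, ?_⟩
  · intro z hz
    rw [minSet, Set.mem_ofPred_eq, hg.translationLength_eq hT hxy]
    rcases Sym2.mem_iff.1 hz with rfl | rfl
    · exact hg.left
    · exact hg.right hT hxy
  · intro z hz
    rw [mem_halfTree_iff hT hxy]
    rw [Sym2.map_mk] at hz
    have := hg.left
    have := hg.inner
    have := hg.outer
    have := hg.right hT hxy
    rcases Sym2.mem_iff.1 hz with rfl | rfl
    · right; omega
    · right; omega

lemma pushes_of_mem_APlus {G : Subgroup (T ≃g T)} {x y : V} {g : T ≃g T} (hT : T.IsTree)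
    (hxy : T.Adj x y) (hg : g ∈ APlus G x s(x, y)) (h1 : g ≠ 1) :
    g ∈ G ∧ Pushes x y (translationLength g) g := by
  rcases hg with ⟨hG, hyp, hmin, hhalf⟩ | h
  · refine ⟨hG, ?_⟩
    have hx := hmin x (Sym2.mem_mk_left x y)
    have hy := hmin y (Sym2.mem_mk_right x y)
    rw [minSet, Set.mem_ofPred_eq] at hx hy
    have hgx := hhalf (g x) (by rw [Sym2.map_mk]; exact Sym2.mem_mk_left _ _)
    have hgy := hhalf (g y) (by rw [Sym2.map_mk]; exact Sym2.mem_mk_right _ _)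
    rw [mem_halfTree_iff hT hxy] at hgx hgy
    replace hgx := hgx.resolve_left (hyp.1 x)
    rcases hgy with hgy | hgy
    -- If `g y = x`, the common displacement is 1, so `g x = y` and `g` inverts the edge.
    · exfalso
      rw [hgy, T.dist_comm, SimpleGraph.dist_eq_one_iff_adj.2 hxy] at hy
      have h0 : T.dist y (g x) = 0 := by omega
      rw [hT.connected.dist_eq_zero_iff] at h0
      exact hyp.2 s(x, y) hxy (by rw [Sym2.map_mk, ← h0, hgy, Sym2.eq_swap])
    · exact ⟨hx, by omega, by omega⟩
  · exact absurd h h1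

lemma translationLength_one [Nonempty V] : translationLength (1 : T ≃g T) = 0 := by
  have : (fun v : V => T.dist v ((1 : T ≃g T) v)) = fun _ => 0 := by
    funext v
    simp [one_apply]
  rw [translationLength, this, Set.range_const]
  simp

lemma mem_APlus_and_translationLength_eq_two_iff {G : Subgroup (T ≃g T)} {x y : V} {g : T ≃g T}
    (hT : T.IsTree) (hxy : T.Adj x y) :
    g ∈ APlus G x s(x, y) ∧ translationLength g = 2 ↔ g ∈ G ∧ Pushes x y 2 g := by
  have : Nonempty V := ⟨x⟩
  constructor
  · rintro ⟨hg, h2⟩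
    rw [← h2]
    refine pushes_of_mem_APlus hT hxy hg ?_
    rintro rfl
    rw [translationLength_one] at h2
    omega
  · rintro ⟨hG, hg⟩
    exact ⟨hg.mem_APlus hT hxy hG, hg.translationLength_eq hT hxy⟩

end BurgerMozes

namespace BurgerMozes

variable {V : Type*} {T : SimpleGraph V}

/-! ### Colors of edges -/

/-- The vertices `v` and `w` are adjacent, and the edge between them has the color `c`. -/
def HasColor {d : ℕ} (ι : T.edgeSet → Fin d) (v w : V) (c : Fin d) : Prop :=
  ∃ h : s(v, w) ∈ T.edgeSet, ι ⟨s(v, w), h⟩ = c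

section Colors

variable {d : ℕ} {ι : T.edgeSet → Fin d} {F : Subgroup (Equiv.Perm (Fin d))}

lemma HasColor.adj {v w : V} {c : Fin d} (h : HasColor ι v w c) : T.Adj v w := h.1

lemma HasColor.symm {v w : V} {c : Fin d} (h : HasColor ι v w c) : HasColor ι w v c := by
  rw [HasColor, Sym2.eq_swap]
  exact h

lemma HasColor.color_unique {v w : V} {c c' : Fin d} (h : HasColor ι v w c)
    (h' : HasColor ι v w c') : c = c' := by
  obtain ⟨_, rfl⟩ := h
  obtain ⟨_, rfl⟩ := h'
  rfl

variable (ι) in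
lemma exists_hasColor {v w : V} (h : T.Adj v w) : ∃ c, HasColor ι v w c := ⟨_, h, rfl⟩

lemma IsLegalColoring.vertex_unique (hι : IsLegalColoring ι) {v w w' : V} {c : Fin d}
    (h : HasColor ι v w c) (h' : HasColor ι v w' c) : w = w' := by
  obtain ⟨h1, h2⟩ := h
  obtain ⟨h1', h2'⟩ := h'
  have := (hι v).injOn (x₁ := ⟨s(v, w), h1⟩) (x₂ := ⟨s(v, w'), h1'⟩)
    (Sym2.mem_mk_left v w) (Sym2.mem_mk_left v w') (h2.trans h2'.symm)
  exact Sym2.congr_right.1 (Subtype.ext_iff.1 this)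

lemma IsLegalColoring.exists_vertex (hι : IsLegalColoring ι) (v : V) (c : Fin d) :
    ∃ w, HasColor ι v w c := by
  obtain ⟨⟨ε, hε⟩, hv, hc⟩ := (hι v).surjOn (Set.mem_univ c)
  obtain ⟨w, rfl⟩ := Sym2.mem_iff_exists.1 hv
  exact ⟨w, hε, hc⟩

lemma actsLocallyBy_iff {g : T ≃g T} {v : V} {σ : Equiv.Perm (Fin d)} :
    ActsLocallyBy ι g v σ ↔ ∀ w c, HasColor ι v w c → HasColor ι (g v) (g w) (σ c) := by
  constructor
  · rintro h w c ⟨hw, rfl⟩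
    exact ⟨_, h ⟨s(v, w), hw⟩ (Sym2.mem_mk_left v w)⟩
  · rintro h ⟨ε, hε⟩ hv
    obtain ⟨w, rfl⟩ := Sym2.mem_iff_exists.1 hv
    obtain ⟨_, h2⟩ := h w _ ⟨hε, rfl⟩
    exact h2

lemma mem_universalGroup_iff {g : T ≃g T} :
    g ∈ universalGroup ι F ↔
      ∀ v, ∃ σ ∈ F, ∀ w c, HasColor ι v w c → HasColor ι (g v) (g w) (σ c) := by
  simp_rw [← actsLocallyBy_iff]
  rfl

/-! ### Automorphisms with constant local action -/

/-- The end of the walk from `a` along the colors of `p`, permuted by `σ`. -/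
def followColors (ι : T.edgeSet → Fin d) (nbr : V → Fin d → V) (σ : Equiv.Perm (Fin d)) :
    ∀ {u z : V}, T.Walk u z → V → V
  | _, _, .nil, a => a
  | u, _, .cons (v := v) h p, a => followColors ι nbr σ p (nbr a (σ (ι ⟨s(u, v), h⟩)))

lemma followColors_concat {nbr : V → Fin d → V} {σ : Equiv.Perm (Fin d)} {u z w : V}
    (p : T.Walk u z) (h : T.Adj z w) (a : V) :
    followColors ι nbr σ (p.concat h) a =
      nbr (followColors ι nbr σ p a) (σ (ι ⟨s(z, w), h⟩)) := by
  induction p generalizing a with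
  | nil => rfl
  | cons h' p ih =>
    rw [SimpleGraph.Walk.concat_cons]
    exact ih h _

/-- Read the colors along the geodesic from `v` to `z` and follow their images under `σ`. The
geodesic to the farther end of an edge extends the one to the nearer end, so every edge is
respected. -/
lemma exists_map_of_perm (hT : T.IsTree) (hι : IsLegalColoring ι) (σ : Equiv.Perm (Fin d))
    (v : V) : ∃ g : V → V, g v = v ∧
      ∀ z w c, HasColor ι z w c → HasColor ι (g z) (g w) (σ c) := by
  choose nbr hnbr using hι.exists_vertex
  choose p hp hp' using fun z => hT.connected.exists_path_of_dist v z
  have huniq : ∀ z (q : T.Walk v z), q.length = T.dist v z → q = p z := fun z q hq =>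
    congrArg Subtype.val ((hT.isAcyclic.subsingleton_path v z).elim
      ⟨q, q.isPath_of_length_eq_dist hq⟩ ⟨p z, hp z⟩)
  have key : ∀ z w c, HasColor ι z w c → T.dist v w = T.dist v z + 1 →
      HasColor ι (followColors ι nbr σ (p z) v) (followColors ι nbr σ (p w) v) (σ c) := by
    rintro z w c ⟨h, rfl⟩ hd
    have hadj : T.Adj z w := h
    rw [← huniq w ((p z).concat hadj) (by rw [SimpleGraph.Walk.length_concat, hp', hd]),
      followColors_concat]
    exact hnbr _ _
  refine ⟨fun z => followColors ι nbr σ (p z) v, ?_, fun z w c h => ?_⟩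
  · change followColors ι nbr σ (p v) v = v
    rw [← huniq v .nil (by simp)]
    rfl
  · rcases hT.dist_eq_dist_add_one_of_adj v h.adj with hd | hd
    · exact (key w z c h.symm hd).symm
    · exact key z w c h hd

lemma map_eq_of_hasColor (hT : T.Connected) (hι : IsLegalColoring ι) {f : V → V} {v : V}
    (hv : f v = v) (hf : ∀ z w c, HasColor ι z w c → HasColor ι (f z) (f w) c) (z : V) :
    f z = z := by
  obtain ⟨p⟩ := hT v z
  induction p with
  | nil => exact hv
  | cons h p ih =>
    obtain ⟨c, hc⟩ := exists_hasColor ι h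
    have h1 := hf _ _ _ hc
    rw [hv] at h1
    exact ih (hι.vertex_unique h1 hc)

/-- Every permutation of the colors is the local action, at each vertex, of an automorphism
that fixes a prescribed vertex. -/
lemma exists_aut_of_perm (hT : T.IsTree) (hι : IsLegalColoring ι) (σ : Equiv.Perm (Fin d))
    (v : V) : ∃ g : T ≃g T, g v = v ∧
      ∀ z w c, HasColor ι z w c → HasColor ι (g z) (g w) (σ c) := by
  obtain ⟨f, hfv, hf⟩ := exists_map_of_perm hT hι σ v
  obtain ⟨f', hfv', hf'⟩ := exists_map_of_perm hT hι σ⁻¹ v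
  have h1 : ∀ z, f' (f z) = z := map_eq_of_hasColor hT.connected hι (f := f' ∘ f) (v := v)
    (by rw [Function.comp_apply, hfv, hfv']) fun z w c h => by simpa using hf' _ _ _ (hf _ _ _ h)
  have h2 : ∀ z, f (f' z) = z := map_eq_of_hasColor hT.connected hι (f := f ∘ f') (v := v)
    (by rw [Function.comp_apply, hfv', hfv]) fun z w c h => by simpa using hf _ _ _ (hf' _ _ _ h)
  refine ⟨⟨⟨f, f', h1, h2⟩, ?_⟩, hfv, hf⟩
  intro a b
  constructor
  · intro h
    obtain ⟨c, hc⟩ := exists_hasColor ι h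
    have := (hf' _ _ _ hc).adj
    change T.Adj (f' (f a)) (f' (f b)) at this
    rwa [h1, h1] at this
  · intro h
    obtain ⟨c, hc⟩ := exists_hasColor ι h
    exact (hf _ _ _ hc).adj

/-! ### Transitivity of the stabilizers in `U(F)⁺` -/

lemma universalGroupPlus_le : universalGroupPlus ι F ≤ universalGroup ι F :=
  (Subgroup.closure_le _).2 fun _ h => h.1

lemma mem_universalGroupPlus_of_fixes {g : T ≃g T} (hg : g ∈ universalGroup ι F) {a b : V}
    (hab : T.Adj a b) (ha : g a = a) (hb : g b = b) : g ∈ universalGroupPlus ι F :=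
  Subgroup.subset_closure ⟨hg, a, b, hab, ha, hb⟩

/-- If all point stabilizers of `F` are trivial, so is `U(F)⁺`. -/
lemma universalGroupPlus_eq_bot (hT : T.IsTree) (hι : IsLegalColoring ι)
    (hF : ∀ σ ∈ F, ∀ c, σ c = c → σ = 1) : universalGroupPlus ι F = ⊥ := by
  rw [universalGroupPlus, Subgroup.closure_eq_bot_iff]
  rintro g ⟨hg, a, b, hab, ha, hb⟩
  rw [mem_universalGroup_iff] at hg
  -- A fixed edge at a fixed vertex forces trivial local action there; this spreads along walks.
  have key : ∀ (z : V), ∀ w, T.Adj z w → g z = z → g w = w →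
      ∀ w', T.Adj z w' → g w' = w' := by
    intro z w hzw hz hw w' hw'
    obtain ⟨σ, hσ, h⟩ := hg z
    obtain ⟨c, hc⟩ := exists_hasColor ι hzw
    obtain ⟨c', hc'⟩ := exists_hasColor ι hw'
    have h1 := h _ _ hc
    rw [hz, hw] at h1
    have h2 := h _ _ hc'
    rw [hF σ hσ c (h1.color_unique hc), hz] at h2
    exact hι.vertex_unique h2 hc'
  have hfix : ∀ z, g z = z ∧ ∃ w, T.Adj z w ∧ g w = w := by
    intro z
    obtain ⟨p⟩ := hT.connected a z
    induction p generalizing b with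
    | nil => exact ⟨ha, b, hab, hb⟩
    | @cons u v z h p ih => exact ih _ h.symm (key u b hab ha hb v h) ha
  exact RelIso.ext fun z => (hfix z).1

/-- The point stabilizers of F generate a normal subgroup `N`, nontrivial on colors because U(F)⁺ is
nontrivial, hence transitive by primitivity. Each generator is realized at `v` by an automorphism
with constant local action that fixes an edge at `v`. -/
lemma exists_mem_universalGroupPlus_map_adj [hF : MulAction.IsPreprimitive F (Fin d)]
    (hT : T.IsTree) (hι : IsLegalColoring ι) (hne : universalGroupPlus ι F ≠ ⊥) {v a b : V}
    (ha : T.Adj v a) (hb : T.Adj v b) :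
    ∃ g ∈ universalGroupPlus ι F, g v = v ∧ g a = b := by
  let N : Subgroup F := Subgroup.closure {σ | ∃ c : Fin d, σ • c = c}
  have hN : N.Normal := by
    rw [← Subgroup.normalizer_eq_top_iff, eq_top_iff, Subgroup.le_normalizer_closure_iff]
    rintro τ - σ ⟨c, hc⟩
    exact Subgroup.subset_closure ⟨τ • c, by rw [mul_smul, mul_smul, inv_smul_smul, hc]⟩
  have hfix : MulAction.fixedPoints N (Fin d) ≠ .univ := by
    intro h
    refine hne (universalGroupPlus_eq_bot hT hι fun σ hσ c hc => ?_)
    ext c'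
    have hc' : c' ∈ MulAction.fixedPoints N (Fin d) := by rw [h]; trivial
    have := hc' ⟨⟨σ, hσ⟩, Subgroup.subset_closure ⟨c, hc⟩⟩
    exact congrArg Fin.val this
  have htrans : MulAction.IsPretransitive N (Fin d) :=
    MulAction.IsQuasiPreprimitive.isPretransitive_of_normal (G := F) hfix
  have hreal : ∀ σ ∈ N, ∃ g ∈ universalGroupPlus ι F, g v = v ∧
      ∀ w c, HasColor ι v w c → HasColor ι v (g w) (σ • c) := by
    intro σ hσ
    induction hσ using Subgroup.closure_induction with
    | mem σ hσ =>
      obtain ⟨c, hc⟩ := hσ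
      obtain ⟨g, hgv, hg⟩ := exists_aut_of_perm hT hι (σ : Equiv.Perm (Fin d)) v
      obtain ⟨w, hw⟩ := hι.exists_vertex v c
      have hw' := hg _ _ _ hw
      rw [hgv] at hw'
      have hgw : g w = w := by
        refine hι.vertex_unique (v := v) (c := c) ?_ hw
        have hc' : (σ : Equiv.Perm (Fin d)) c = c := hc
        rwa [hc'] at hw'
      refine ⟨g, mem_universalGroupPlus_of_fixes ?_ hw.adj hgv hgw, hgv, fun z c' hz => ?_⟩
      · exact mem_universalGroup_iff.2 fun z => ⟨σ, σ.2, hg z⟩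
      · have := hg _ _ _ hz
        rwa [hgv] at this
    | one => exact ⟨1, one_mem _, rfl, fun w c h => by simpa using h⟩
    | mul σ τ _ _ hσ hτ =>
      obtain ⟨g, hg, hgv, hgc⟩ := hσ
      obtain ⟨h, hh, hhv, hhc⟩ := hτ
      refine ⟨g * h, mul_mem hg hh, by rw [mul_apply, hhv, hgv], fun w c hw => ?_⟩
      rw [mul_smul]
      exact hgc _ _ (hhc _ _ hw)
    | inv σ _ hσ =>
      obtain ⟨g, hg, hgv, hgc⟩ := hσ
      have hgv' : g⁻¹ v = v := by rw [← hgv, inv_apply_self, hgv]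
      refine ⟨g⁻¹, inv_mem hg, hgv', fun w c hw => ?_⟩
      have hadj : T.Adj v (g⁻¹ w) := by
        rw [← hgv']
        exact (g⁻¹).map_adj_iff.2 hw.adj
      obtain ⟨c', hc'⟩ := exists_hasColor ι hadj
      have h1 := hgc _ _ hc'
      rw [apply_inv_self] at h1
      rw [hw.color_unique h1, inv_smul_smul]
      exact hc'
  obtain ⟨c, hc⟩ := exists_hasColor ι ha
  obtain ⟨c', hc'⟩ := exists_hasColor ι hb
  obtain ⟨σ, hσ⟩ := MulAction.exists_smul_eq N c c'
  obtain ⟨g, hg, hgv, hgc⟩ := hreal σ σ.2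
  refine ⟨g, hg, hgv, hι.vertex_unique (hgc _ _ hc) ?_⟩
  have : (σ : F) • c = c' := hσ
  rwa [this]

/-- Rotate about `y` to take `x` to `z`, then about `z` to take `y` to `w`. -/
lemma exists_mem_universalGroupPlus_map_edge [hF : MulAction.IsPreprimitive F (Fin d)]
    (hT : T.IsTree) (hι : IsLegalColoring ι) (hne : universalGroupPlus ι F ≠ ⊥) {x y z w : V}
    (hxy : T.Adj x y) (hyz : T.Adj y z) (hzw : T.Adj z w) :
    ∃ g ∈ universalGroupPlus ι F, g x = z ∧ g y = w := by
  obtain ⟨g, hg, hgy, hgx⟩ := exists_mem_universalGroupPlus_map_adj hT hι hne hxy.symm hyz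
  obtain ⟨h, hh, hhz, hhy⟩ := exists_mem_universalGroupPlus_map_adj hT hι hne hyz.symm hzw
  exact ⟨h * g, mul_mem hh hg, by rw [mul_apply, hgx, hhz], by rw [mul_apply, hgy, hhy]⟩

/-- A generator fixes some `a`, and `v` and `g v` are equidistant from `a`; parity is additive over
products. -/
lemma even_dist_of_mem_universalGroupPlus (hT : T.IsTree) {g : T ≃g T}
    (hg : g ∈ universalGroupPlus ι F) (v : V) : Even (T.dist v (g v)) := by
  induction hg using Subgroup.closure_induction generalizing v with
  | mem g hg =>
    obtain ⟨-, a, -, -, ha, -⟩ := hg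
    have h1 := even_dist_triangle hT v a (g v)
    have h2 := dist_map hT.connected g a v
    rw [ha, T.dist_comm (u := a) (v := v)] at h2
    rw [h2, ← two_mul] at h1
    exact (Nat.even_add.1 h1).1 (even_two_mul _)
  | one => simp [one_apply]
  | mul g h _ _ hg hh =>
    have h1 := even_dist_triangle hT v (h v) (g (h v))
    exact (Nat.even_add.1 h1).1 ((hh v).add (hg (h v)))
  | inv g _ hg =>
    have := hg (g⁻¹ v)
    rwa [apply_inv_self, T.dist_comm] at this

/-! ### Tits' independence property -/

lemma eq_and_eq_of_adj_of_dist_lt (hT : T.IsTree) {a b z w : V} (hab : T.Adj a b)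
    (hzw : T.Adj z w) (hz : T.dist z a < T.dist z b) (hw : ¬ T.dist w a < T.dist w b) :
    z = a ∧ w = b := by
  have h1 := hT.dist_eq_dist_add_one_of_adj z hab
  have h2 := hT.dist_eq_dist_add_one_of_adj w hab
  have h3 := dist_eq_of_edge_between hT (x := z) (w := w) hab (by omega)
    (by rw [T.dist_comm (u := a), T.dist_comm (u := b)]; omega)
  rw [SimpleGraph.dist_eq_one_iff_adj.2 hzw] at h3
  constructor
  · exact hT.connected.dist_eq_zero_iff.1 (by omega)
  · exact (hT.connected.dist_eq_zero_iff.1 (by omega)).symm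

open Classical in
/-- The automorphism that is the identity on the half-tree of the vertices closer to `a` than
to `b`, and agrees with `u` on the other one. -/
noncomputable def halfAut (hT : T.IsTree) {a b : V} (hab : T.Adj a b) (u : T ≃g T)
    (ha : u a = a) (hb : u b = b) : T ≃g T where
  toFun z := if T.dist z a < T.dist z b then z else u z
  invFun z := if T.dist z a < T.dist z b then z else u⁻¹ z
  left_inv z := by
    by_cases hz : T.dist z a < T.dist z b
    · simp [hz]
    · have : ¬ T.dist (u z) a < T.dist (u z) b := by
        have h1 := dist_map hT.connected u z a
        have h2 := dist_map hT.connected u z b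
        rw [ha] at h1
        rw [hb] at h2
        rwa [h1, h2]
      simp only [if_neg hz, if_neg this, inv_apply_self]
  right_inv z := by
    by_cases hz : T.dist z a < T.dist z b
    · simp [hz]
    · have : ¬ T.dist (u⁻¹ z) a < T.dist (u⁻¹ z) b := by
        rw [← dist_map hT.connected u, ← dist_map hT.connected u _ b, apply_inv_self, ha, hb]
        exact hz
      simp only [if_neg hz, if_neg this, apply_inv_self]
  map_rel_iff' := by
    intro z w
    have hu : ∀ w, (T.dist (u w) a < T.dist (u w) b ↔ T.dist w a < T.dist w b) := by
      intro w
      rw [← dist_map hT.connected u w a, ← dist_map hT.connected u w b, ha, hb]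
    have key : ∀ z w, T.dist z a < T.dist z b → ¬ T.dist w a < T.dist w b →
        (T.Adj z (u w) ↔ T.Adj z w) := by
      intro z w hz hw
      constructor
      · intro h
        obtain ⟨rfl, h2⟩ := eq_and_eq_of_adj_of_dist_lt hT hab h hz (by rwa [hu])
        rw [← hb] at h2
        rwa [u.injective h2]
      · intro h
        obtain ⟨rfl, rfl⟩ := eq_and_eq_of_adj_of_dist_lt hT hab h hz hw
        rwa [hb]
    change T.Adj (if T.dist z a < T.dist z b then z else u z)
      (if T.dist w a < T.dist w b then w else u w) ↔ T.Adj z w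
    by_cases hz : T.dist z a < T.dist z b <;> by_cases hw : T.dist w a < T.dist w b
    · rw [if_pos hz, if_pos hw]
    · rw [if_pos hz, if_neg hw, key z w hz hw]
    · rw [if_neg hz, if_pos hw, T.adj_comm, key w z hw hz, T.adj_comm]
    · rw [if_neg hz, if_neg hw, u.map_adj_iff]

/-- Only the edge `ab` joins the two half-trees, and `u` fixes its ends. So each local action is
that of the identity or of `u`, and both lie in `F`. -/
lemma exists_mem_universalGroup_half (hT : T.IsTree) {a b : V} (hab : T.Adj a b) {u : T ≃g T}
    (hu : u ∈ universalGroup ι F) (ha : u a = a) (hb : u b = b) :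
    ∃ u' ∈ universalGroup ι F, (∀ z, T.dist z a < T.dist z b → u' z = z) ∧
      ∀ z, ¬ T.dist z a < T.dist z b → u' z = u z := by
  have hpos : ∀ z, T.dist z a < T.dist z b → halfAut hT hab u ha hb z = z :=
    fun z hz => if_pos hz
  have hneg : ∀ z, ¬ T.dist z a < T.dist z b → halfAut hT hab u ha hb z = u z :=
    fun z hz => if_neg hz
  refine ⟨halfAut hT hab u ha hb, ?_, hpos, hneg⟩
  rw [mem_universalGroup_iff] at hu ⊢
  intro v
  by_cases hv : T.dist v a < T.dist v b
  · refine ⟨1, one_mem _, fun w c hc => ?_⟩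
    rw [hpos v hv]
    by_cases hw : T.dist w a < T.dist w b
    · rwa [hpos w hw]
    · obtain ⟨rfl, rfl⟩ := eq_and_eq_of_adj_of_dist_lt hT hab hc.adj hv hw
      rwa [hneg w hw, hb]
  · obtain ⟨σ, hσ, h⟩ := hu v
    refine ⟨σ, hσ, fun w c hc => ?_⟩
    rw [hneg v hv]
    by_cases hw : T.dist w a < T.dist w b
    · obtain ⟨rfl, rfl⟩ := eq_and_eq_of_adj_of_dist_lt hT hab hc.adj.symm hw hv
      have := h _ _ hc
      rw [ha] at this
      rwa [hpos w hw]
    · rw [hneg w hw]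
      exact h _ _ hc

end Colors

end BurgerMozes

namespace BurgerMozes

variable {V : Type*} {T : SimpleGraph V} {d : ℕ} {ι : T.edgeSet → Fin d}
  {F : Subgroup (Equiv.Perm (Fin d))}

/-! ### Decomposition into elements of translation length two -/

lemma exists_list_of_pushes [hF : MulAction.IsPreprimitive F (Fin d)] (hT : T.IsTree)
    (hι : IsLegalColoring ι) {x y : V} (hxy : T.Adj x y) (m : ℕ) {γ : T ≃g T}
    (hγ : γ ∈ universalGroupPlus ι F) (hp : Pushes x y (2 * (m + 1)) γ) :
    ∃ l : List (T ≃g T), (∀ a ∈ l, a ∈ universalGroupPlus ι F ∧ Pushes x y 2 a) ∧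
      γ = l.prod := by
  induction m generalizing γ with
  | zero => exact ⟨[γ], by simpa using ⟨hγ, hp⟩, by simp⟩
  | succ m ih =>
    -- Transitivity needs a nontrivial group; `γ` itself is the witness.
    have hne : universalGroupPlus ι F ≠ ⊥ := by
      intro h
      rw [h, Subgroup.mem_bot] at hγ
      have := hp.left
      rw [hγ, one_apply, SimpleGraph.dist_self] at this
      omega
    have h1 := hp.left
    have h2 := hp.inner
    have h3 := hp.outer
    -- `z` and `w` are the next two vertices after `y` on the geodesic to `γ x`, which has length at
    -- least 4.
    obtain ⟨z, hyz, hz⟩ := exists_adj_dist_lt hT.connected (a := y) (b := γ x)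
      (by
        intro h
        have hxy' := SimpleGraph.dist_eq_one_iff_adj.2 hxy
        rw [← h, hxy'] at h1
        omega)
    obtain ⟨w, hzw, hw⟩ := exists_adj_dist_lt hT.connected (a := z) (b := γ x)
      (by
        intro h
        have hyz' := SimpleGraph.dist_eq_one_iff_adj.2 hyz
        rw [← h, hyz'] at h2
        omega)
    obtain ⟨a, ha, hax, hay⟩ := exists_mem_universalGroupPlus_map_edge hT hι hne hxy hyz hzw
    have e1 := SimpleGraph.dist_eq_one_iff_adj.2 hxy
    have e2 := SimpleGraph.dist_eq_one_iff_adj.2 hyz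
    have e3 := SimpleGraph.dist_eq_one_iff_adj.2 hzw
    have e4 : T.dist (γ x) (γ y) = 1 := by rw [dist_map hT.connected, e1]
    have t1 := hT.connected.dist_triangle (u := x) (v := y) (w := z)
    have t2 := hT.connected.dist_triangle (u := x) (v := z) (w := γ x)
    have t3 := hT.connected.dist_triangle (u := x) (v := z) (w := w)
    have t4 := hT.connected.dist_triangle (u := x) (v := w) (w := γ x)
    have t5 := hT.connected.dist_triangle (u := x) (v := z) (w := γ y)
    have t6 := hT.connected.dist_triangle (u := z) (v := γ x) (w := γ y)
    have hpa : Pushes x y 2 a := by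
      constructor
      · rw [hax]; omega
      · rw [hax]; omega
      · rw [hay]; omega
    have hpb : Pushes x y (2 * (m + 1)) (a⁻¹ * γ) := by
      constructor
      · rw [mul_apply, dist_inv_map hT.connected, hax]; omega
      · rw [mul_apply, dist_inv_map hT.connected, hay]; omega
      · rw [mul_apply, dist_inv_map hT.connected, hax]; omega
    obtain ⟨l, hl, hprod⟩ := ih (mul_mem (inv_mem ha) hγ) hpb
    refine ⟨a :: l, ?_, by rw [List.prod_cons, ← hprod, mul_inv_cancel_left]⟩
    rintro b (_ | ⟨_, hb⟩)
    · exact ⟨ha, hpa⟩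
    · exact hl b hb

theorem exists_prod_of_mem_APlus [hF : MulAction.IsPreprimitive F (Fin d)] (hT : T.IsTree)
    (hι : IsLegalColoring ι) {x y : V} (hxy : T.Adj x y) {γ : T ≃g T}
    (hγ : γ ∈ APlus (universalGroupPlus ι F) x s(x, y)) :
    ∃ (t : ℕ) (g : Fin t → (T ≃g T)),
      (∀ i, g i ∈ APlus (universalGroupPlus ι F) x s(x, y) ∧ translationLength (g i) = 2) ∧
      γ = (List.ofFn g).prod := by
  by_cases h1 : γ = 1
  · exact ⟨0, Fin.elim0, fun i => i.elim0, by simpa using h1⟩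
  obtain ⟨hG, hp⟩ := pushes_of_mem_APlus hT hxy hγ h1
  obtain ⟨m, hm⟩ := even_dist_of_mem_universalGroupPlus hT hG x
  rw [hp.left] at hm
  have := hp.inner
  have hm' : translationLength γ = 2 * (m - 1 + 1) := by omega
  rw [hm'] at hp
  obtain ⟨l, hl, hprod⟩ := exists_list_of_pushes hT hι hxy (m - 1) hG hp
  refine ⟨l.length, l.get, fun i => ?_, by rw [List.ofFn_get, hprod]⟩
  exact (mem_APlus_and_translationLength_eq_two_iff hT hxy).2 (hl _ (l.get_mem i))

/-! ### Double cosets -/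

/-- Within `G`, a left coset of the stabilizer of `x` is determined by the image of `x`. -/
lemma doubleCosetK_eq_iff {G : Subgroup (T ≃g T)} {x : V} {a b : T ≃g T} (ha : a ∈ G)
    (hb : b ∈ G) :
    doubleCosetK G x a = doubleCosetK G x b ↔ ∃ k ∈ vertexStabilizer G x, k (a x) = b x := by
  constructor
  · intro h
    have hb' : b ∈ doubleCosetK G x a := by
      rw [h]
      exact DoubleCoset.mem_doubleCoset_self _ _ b
    obtain ⟨k, hk, l, hl, rfl⟩ := DoubleCoset.mem_doubleCoset.1 hb'
    refine ⟨k, hk, ?_⟩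
    rw [mul_apply, mul_apply, hl.2]
  · rintro ⟨k, hk, h⟩
    refine (DoubleCoset.doubleCoset_eq_of_mem ?_).symm
    refine DoubleCoset.mem_doubleCoset.2 ⟨k, hk, a⁻¹ * k⁻¹ * b, ⟨?_, ?_⟩, by group⟩
    · exact mul_mem (mul_mem (inv_mem ha) (inv_mem hk.1)) hb
    · rw [mul_apply, mul_apply, ← h, inv_apply_self, inv_apply_self]

lemma isPrimitivePair_iff {G : Subgroup (T ≃g T)} (hT : T.IsTree) {x y : V} (hxy : T.Adj x y)
    {a b : T ≃g T} (haG : a ∈ G) (hbG : b ∈ G) (ha : Pushes x y 2 a) (hb : Pushes x y 2 b) :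
    IsPrimitivePair G x s(x, y) a b ↔
      ∃ k ∈ vertexStabilizer G x, k (a x) = b x ∧ k (a y) = b y := by
  have ha' := (mem_APlus_and_translationLength_eq_two_iff hT hxy).2 ⟨haG, ha⟩
  have hb' := (mem_APlus_and_translationLength_eq_two_iff hT hxy).2 ⟨hbG, hb⟩
  constructor
  · rintro ⟨-, -, -, -, k, hk, h⟩
    refine ⟨k, hk, ?_⟩
    simp only [Sym2.map_mk, Sym2.eq_iff] at h
    -- The crossed matching would send `a x`, at distance 2 from `x`, to `b y`, at distance 3.
    refine h.resolve_right fun h' => ?_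
    have h1 := dist_map hT.connected k x (a x)
    rw [hk.2, h'.1, ha.left, hb.outer] at h1
    omega
  · rintro ⟨k, hk, h1, h2⟩
    exact ⟨ha'.1, hb'.1, ha'.2, hb'.2, k, hk, by simp only [Sym2.map_mk, h1, h2]⟩

/-- An element that fixes `x` and maps `p` to `q`, both beyond the edge `xy`, fixes `y`. -/
lemma fixes_of_map_eq (hT : T.IsTree) {x y p q : V} (hxy : T.Adj x y) {k : T ≃g T}
    (hk : k x = x) (hp : T.dist x p = T.dist y p + 1) (hq : T.dist x q = T.dist y q + 1)
    (hpq : k p = q) : k y = y := by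
  have e1 := SimpleGraph.dist_eq_one_iff_adj.2 hxy
  have e2 := dist_map hT.connected k x y
  have e3 := dist_map hT.connected k y p
  have e4 := dist_map hT.connected k x p
  rw [hk] at e2 e4
  rw [hpq] at e3 e4
  exact eq_of_dist_eq_on_geodesic hT (x := x) (z := q) e2 (by omega) (by omega)

/-- The orbit under the stabilizer of `x` of the end of the product of two elements pushing the
edge `xy` is determined by the images of the edge under the first and the orbit of the end of the
second. -/
lemma exists_stabilizer_mul_iff (hT : T.IsTree) {x y : V} (hxy : T.Adj x y) {n m : ℕ}
    {a a' b b' : T ≃g T} (haG : a ∈ universalGroupPlus ι F) (haG' : a' ∈ universalGroupPlus ι F)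
    (ha : Pushes x y n a) (ha' : Pushes x y n a') (hb : Pushes x y m b) (hb' : Pushes x y m b') :
    (∃ k ∈ vertexStabilizer (universalGroupPlus ι F) x, k ((a * b) x) = (a' * b') x) ↔
      (∃ k ∈ vertexStabilizer (universalGroupPlus ι F) x, k (a x) = a' x ∧ k (a y) = a' y) ∧
      ∃ k ∈ vertexStabilizer (universalGroupPlus ι F) x, k (b x) = b' x := by
  have eb := hb.inner
  have eb' := hb'.inner
  have fb := hb.left
  have fb' := hb'.left
  constructor
  · rintro ⟨k, hk, h⟩
    have h1 := ha.dist_apply hT hxy (w := b x) (by omega)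
    have h1' := ha'.dist_apply hT hxy (w := b' x) (by omega)
    have hkx : ∀ z, T.dist x (k z) = T.dist x z := fun z => by
      conv_lhs => rw [← hk.2]
      exact dist_map hT.connected k x z
    have h2 : ∀ z, T.dist (k (a z)) (a' (b' x)) = T.dist z (b x) := fun z => by
      rw [← mul_apply a' b', ← h, dist_map hT.connected, mul_apply, dist_map hT.connected]
    have h2' : ∀ z, T.dist (a' z) (a' (b' x)) = T.dist z (b' x) :=
      fun z => dist_map hT.connected _ _ _
    have hax : k (a x) = a' x := by
      refine eq_of_dist_eq_on_geodesic hT (x := x) (z := a' (b' x)) ?_ ?_ ?_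
      · rw [hkx, ha.left, ha'.left]
      · rw [hkx, ha.left, h2]; omega
      · rw [ha'.left, h2']; omega
    have hay : k (a y) = a' y := by
      refine eq_of_dist_eq_on_geodesic hT (x := x) (z := a' (b' x)) ?_ ?_ ?_
      · rw [hkx, ha.outer, ha'.outer]
      · rw [hkx, ha.outer, h2]; omega
      · rw [ha'.outer, h2']; omega
    refine ⟨⟨k, hk, hax, hay⟩, a'⁻¹ * k * a,
      ⟨mul_mem (mul_mem (inv_mem haG') hk.1) haG, ?_⟩, ?_⟩
    · rw [mul_apply, mul_apply, hax, inv_apply_self]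
    · rw [mul_apply, mul_apply, ← mul_apply a b, h, mul_apply, inv_apply_self]
  · rintro ⟨⟨k, hk, hax, hay⟩, l, hl, hlb⟩
    have hly : l y = y := fixes_of_map_eq hT hxy hl.2 (p := b x) (q := b' x) (by omega)
      (by omega) hlb
    have hadj : T.Adj (a x) (a y) := a.map_adj_iff.2 hxy
    have hinv : ∀ z, k (a z) = a' z → k⁻¹ (a' z) = a z := fun z h => by
      rw [← h, inv_apply_self]
    -- Following this element by `k` takes `a (b x)` to `a' (b' x)`, but it may move `x`. As it
    -- fixes the edge from `a x` to `a y`, it can be replaced by the identity on the side of `a x`,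
    -- which contains `x` and `y`. The result fixes the edge `xy`, so it lies in U(F)⁺ and not just
    -- in U(F).
    have hu : k⁻¹ * a' * l * a⁻¹ ∈ universalGroupPlus ι F :=
      mul_mem (mul_mem (mul_mem (inv_mem hk.1) haG') hl.1) (inv_mem haG)
    have hu_apply : ∀ z, (k⁻¹ * a' * l * a⁻¹) (a z) = k⁻¹ (a' (l z)) := fun z => by
      simp only [mul_apply, inv_apply_self]
    obtain ⟨u, hu, hu1, hu2⟩ := exists_mem_universalGroup_half (F := F) hT hadj
      (universalGroupPlus_le hu) (by rw [hu_apply, hl.2, hinv x hax])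
      (by rw [hu_apply, hly, hinv y hay])
    have hux : u x = x := hu1 x (by rw [ha.left, ha.outer]; omega)
    have huy : u y = y := hu1 y (by
      have := ha.inner
      have := ha.right hT hxy
      omega)
    refine ⟨k * u, mul_mem hk ⟨mem_universalGroupPlus_of_fixes hu hxy hux huy, hux⟩, ?_⟩
    rw [mul_apply, mul_apply a b, hu2 (a (b x)), hu_apply, apply_inv_self, hlb, mul_apply]
    rw [dist_map hT.connected, dist_map hT.connected, T.dist_comm, T.dist_comm (u := b x)]
    omega

lemma pushes_prod_ofFn (hT : T.IsTree) {x y : V} (hxy : T.Adj x y) {G : Subgroup (T ≃g T)}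
    (t : ℕ) (g : Fin (t + 1) → (T ≃g T)) (hg : ∀ i, g i ∈ G ∧ Pushes x y 2 (g i)) :
    (List.ofFn g).prod ∈ G ∧ Pushes x y (2 * (t + 1)) (List.ofFn g).prod := by
  induction t with
  | zero => simpa using hg 0
  | succ t ih =>
    obtain ⟨h1, h2⟩ := ih (fun i => g i.succ) (fun i => hg i.succ)
    rw [List.ofFn_succ, List.prod_cons, show 2 * (t + 1 + 1) = 2 + 2 * (t + 1) by ring]
    exact ⟨mul_mem (hg 0).1 h1, (hg 0).2.mul hT hxy h2⟩

/-- Split off the first factor and induct. Every factor with something after it must match on the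
whole edge; the last one only on the image of `x`. -/
lemma exists_stabilizer_prod_iff (hT : T.IsTree) {x y : V} (hxy : T.Adj x y) (t : ℕ)
    (g g' : Fin (t + 1) → (T ≃g T))
    (hg : ∀ i, g i ∈ universalGroupPlus ι F ∧ Pushes x y 2 (g i))
    (hg' : ∀ i, g' i ∈ universalGroupPlus ι F ∧ Pushes x y 2 (g' i)) :
    (∃ k ∈ vertexStabilizer (universalGroupPlus ι F) x,
        k ((List.ofFn g).prod x) = (List.ofFn g').prod x) ↔
      (∀ i : Fin t, ∃ k ∈ vertexStabilizer (universalGroupPlus ι F) x,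
        k (g i.castSucc x) = g' i.castSucc x ∧ k (g i.castSucc y) = g' i.castSucc y) ∧
      ∃ k ∈ vertexStabilizer (universalGroupPlus ι F) x,
        k (g (Fin.last t) x) = g' (Fin.last t) x := by
  induction t with
  | zero => simp
  | succ t ih =>
    have ih' := ih (fun i => g i.succ) (fun i => g' i.succ) (fun i => hg i.succ)
      (fun i => hg' i.succ)
    have hb := (pushes_prod_ofFn hT hxy t (fun i => g i.succ) (fun i => hg i.succ)).2
    have hb' := (pushes_prod_ofFn hT hxy t (fun i => g' i.succ) (fun i => hg' i.succ)).2
    rw [List.ofFn_succ (f := g), List.ofFn_succ (f := g'), List.prod_cons, List.prod_cons,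
      exists_stabilizer_mul_iff hT hxy (hg 0).1 (hg' 0).1 (hg 0).2 (hg' 0).2 hb hb', ih',
      Fin.forall_fin_succ, and_assoc]
    rfl

theorem doubleCosetK_prod_eq_iff (hT : T.IsTree) {x y : V} (hxy : T.Adj x y) (t : ℕ)
    (g g' : Fin (t + 1) → (T ≃g T))
    (hg : ∀ i, g i ∈ APlus (universalGroupPlus ι F) x s(x, y) ∧ translationLength (g i) = 2)
    (hg' : ∀ i, g' i ∈ APlus (universalGroupPlus ι F) x s(x, y) ∧
      translationLength (g' i) = 2) :
    doubleCosetK (universalGroupPlus ι F) x (List.ofFn g).prod =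
        doubleCosetK (universalGroupPlus ι F) x (List.ofFn g').prod ↔
      (∀ i : Fin t, IsPrimitivePair (universalGroupPlus ι F) x s(x, y)
        (g i.castSucc) (g' i.castSucc)) ∧
      doubleCosetK (universalGroupPlus ι F) x (g (Fin.last t)) =
        doubleCosetK (universalGroupPlus ι F) x (g' (Fin.last t)) := by
  simp only [mem_APlus_and_translationLength_eq_two_iff hT hxy] at hg hg'
  rw [doubleCosetK_eq_iff (pushes_prod_ofFn hT hxy t g hg).1 (pushes_prod_ofFn hT hxy t g' hg').1,
    exists_stabilizer_prod_iff hT hxy t g g' hg hg', doubleCosetK_eq_iff (hg _).1 (hg' _).1]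
  refine and_congr_left' (forall_congr' fun i => ?_)
  rw [isPrimitivePair_iff hT hxy (hg _).1 (hg' _).1 (hg _).2 (hg' _).2]

end BurgerMozes

theorem proposition3p7 {V : Type*} (T : SimpleGraph V) [T.LocallyFinite] (d : ℕ) (hd : 3 ≤ d)
    (hT : T.IsTree) (hreg : T.IsRegularOfDegree d)
    (ι : T.edgeSet → Fin d) (hι : BurgerMozes.IsLegalColoring ι)
    (F : Subgroup (Equiv.Perm (Fin d))) (hF : MulAction.IsPreprimitive F (Fin d))
    (x : V) (e : Sym2 V) (he : e ∈ T.incidenceSet x)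
    (G : Subgroup (T ≃g T)) (hG : G = BurgerMozes.universalGroupPlus ι F) :
    (∀ γ ∈ BurgerMozes.APlus G x e,
      ∃ (t : ℕ) (g : Fin t → (T ≃g T)),
        (∀ i, g i ∈ BurgerMozes.APlus G x e ∧ BurgerMozes.translationLength (g i) = 2) ∧
        γ = (List.ofFn g).prod) ∧
    (∀ (t : ℕ) (g g' : Fin (t + 1) → (T ≃g T)),
      (∀ i, g i ∈ BurgerMozes.APlus G x e ∧ BurgerMozes.translationLength (g i) = 2) →
      (∀ i, g' i ∈ BurgerMozes.APlus G x e ∧ BurgerMozes.translationLength (g' i) = 2) →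
      (BurgerMozes.doubleCosetK G x (List.ofFn g).prod =
          BurgerMozes.doubleCosetK G x (List.ofFn g').prod ↔
        (∀ i : Fin t, BurgerMozes.IsPrimitivePair G x e (g i.castSucc) (g' i.castSucc)) ∧
        BurgerMozes.doubleCosetK G x (g (Fin.last t)) =
          BurgerMozes.doubleCosetK G x (g' (Fin.last t)))) := by
  subst hG
  obtain ⟨y, rfl⟩ := Sym2.mem_iff_exists.1 he.2
  have hxy : T.Adj x y := he.1
  exact ⟨fun γ hγ => BurgerMozes.exists_prod_of_mem_APlus hT hι hxy hγ,
    fun t g g' hg hg' => BurgerMozes.doubleCosetK_prod_eq_iff hT hxy t g g' hg hg'⟩
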